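/- A meet semi-lattice $L$ is \emph{distributive} if $b_1\wedge b_2\le a$ implies $a=c_1\wedge c_2$ for some $c_1\ge b_1$, $c_2\ge b_2$. Let $L$ range over bounded distributive meet semi-lattices (with $\top$ and $\bot$). A filter of $L$ (nonempty upset closed under $\wedge$) is \emph{prime} if it is proper and, whenever it contains $F_1\cap F_2$ for filters $F_1,F_2$, it contains $F_1$ or $F_2$; $\mathrm{Pr}(L)$ is the set of prime filters, $\sigma(a)=\{x\in \mathrm{Pr}(L):a\in x\}$, and $D(L)$ is the sublattice of $\mathcal P(\mathrm{Pr}(L))$ generated by $\sigma[L]$. A filter of $L$ is \emph{optimal} if it is $\sigma^{-1}(P)$ for a prime filter $P$ of $D(L)$. Let $L_*$ be the set of optimal filters, ordered by inclusion, with the topology that has the sets $\varphi(a)=\{x\in L_*:a\in x\}$ and their complements as a subbasis, and with the distinguished subset $L_+=\mathrm{Pr}(L)\subseteq L_*$. For an ordered topological space $X$ and $X_0\subseteq X$, let $X^*$ be the set of clopen upsets $U$ of $X$ such that every maximal point of $X\setminus U$ lies in $X_0$. A \emph{generalized Priestley space} is a Priestley space $X$ (a compact ordered space in which, if $x\not\le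 y$, some clopen upset contains $x$ but not $y$) with a dense subset $X_0$ such that: every $x\in X$ is below some $y\in X_0$; $x\in X_0$ iff the family $\{U\in X^*:x\notin U\}$ is directed by inclusion; and $x\le y$ iff every $U\in X^*$ that contains $x$ contains $y$. Then $X^*$ is ordered by inclusion, with meet $\cap$, top $X$ and bottom $\emptyset$. For $R\subseteq X\times Y$ put $R[x]=\{y:xRy\}$ and $\Box_RU=\{x:R[x]\subseteq U\}$. A \emph{generalized Priestley morphism} from $X$ to $Y$ is a relation $R\subseteq X\times Y$ such that $\Box_RU\in X^*$ for all $U\in Y^*$, and such that if not $xRy$, then there is $U\in Y^*$ with $R[x]\subseteq U$ and $y\notin U$. The composite of $R\subseteq X\times Y$ and $S\subseteq Y\times Z$ is $S*R$, where $x(S*R)z$ iff for all $U\in Z^*$, $x\in\Box_R\Box_SU$ implies $z\in U$; the identity of $X$ is $\le$. $R$ is \emph{total} if every $R[x]$ is nonempty, and \emph{functional} if every $R[x]$ has the form ${\uparrow}y$. A \emph{strong Priestley morphism} is an order-preserving map $f:X\to Y$ such that $f^{-1}(U)\in X^*$ for all $U\in Y^*$. A map $h:L\to K$ between bounded distributive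 meet semi-lattices that preserves $\wedge$ and $\top$ is a \emph{bounded homomorphism} if $h(\bot)=\bot$, and a \emph{sup-homomorphism} if for all $n\ge 0$ and $a_1,\dots,a_n,b\in L$, $\bigcap_{i}{\uparrow}a_i\subseteq{\uparrow}b$ implies $\bigcap_i{\uparrow}h(a_i)\subseteq{\uparrow}h(b)$ (an empty intersection being the whole semi-lattice). Let $\mathsf{BDM}^\bot$ and $\mathsf{BDM}^{\mathsf S}$ be the categories of bounded distributive meet semi-lattices with bounded homomorphisms and with sup-homomorphisms, and let $\mathsf{GPS}^{\mathsf T}$, $\mathsf{GPS}^{\mathsf F}$, $\mathsf{GPS}^{\mathsf S}$ be the categories of generalized Priestley spaces with total generalized Priestley morphisms, with functional generalized Priestley morphisms (both composed by $*$), and with strong Priestley morphisms (composed as functions). \textbf{Theorem.} \begin{enumerate} \item $\mathsf{BDM}^\bot$ is dually equivalent to $\mathsf{GPS}^{\mathsf T}$, through mutually quasi-inverse contravariant functors that send $L$ to $(L_*,L_+)$ and $h:L\to K$ to the relation $R_h\subseteq K_*\times L_*$, $xR_hy\iff h^{-1}(x)\subseteq y$, and that send $X$ to $X^*$ and $R\subseteq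 X\times Y$ to $h_R:Y^*\to X^*$, $U\mapsto\Box_RU$. \item $\mathsf{BDM}^{\mathsf S}$ is dually equivalent to $\mathsf{GPS}^{\mathsf F}$, through functors given by the same formulas. \item $\mathsf{GPS}^{\mathsf F}$ and $\mathsf{GPS}^{\mathsf S}$ are isomorphic: the functors that are the identity on spaces and send a functional $R$ to $f^R$, where $f^R(x)$ is the least element of $R[x]$, and a strong Priestley morphism $f$ to $R^f$, where $xR^fy\iff f(x)\le y$, are inverse to each other. \item $\mathsf{BDM}^{\mathsf S}$ is dually equivalent to $\mathsf{GPS}^{\mathsf S}$, through mutually quasi-inverse contravariant functors that send $L$ to $(L_*,L_+)$ and $h$ to $h^{-1}:K_*\to L_*$, and $X$ to $X^*$ and $f:X\to Y$ to $f^{-1}:Y^*\to X^*$. \end{enumerate} -/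

import Mathlib

open CategoryTheory Opposite Set

universe u

/-! ### Distributive meet semi-lattices, their homomorphisms, prime and optimal filters -/

/-- A meet semi-lattice is distributive if `b₁ ⊓ b₂ ≤ a` implies `a = c₁ ⊓ c₂` for some
`c₁ ≥ b₁` and `c₂ ≥ b₂`. -/
def IsDistribMeet (L : Type u) [SemilatticeInf L] : Prop :=
  ∀ a b₁ b₂ : L, b₁ ⊓ b₂ ≤ a → ∃ c₁ c₂ : L, b₁ ≤ c₁ ∧ b₂ ≤ c₂ ∧ a = c₁ ⊓ c₂

/-- Bounded distributive meet semi-lattices. -/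
structure BDM : Type (u + 1) where
  carrier : Type u
  [inf : SemilatticeInf carrier]
  [bdd : BoundedOrder carrier]
  distrib : IsDistribMeet carrier

instance : CoeSort BDM.{u} (Type u) := ⟨BDM.carrier⟩

attribute [instance] BDM.inf BDM.bdd

/-- The category `BDM`: morphisms preserve binary meets and top. -/
instance BDM.category : Category BDM.{u} where
  Hom L K := InfTopHom L K
  id L := InfTopHom.id L
  comp h k := InfTopHom.comp k h

/-- The underlying map of a morphism of `BDM`. -/
def BDM.fn {L K : BDM.{u}} (h : L ⟶ K) : L → K := (show InfTopHom L K from h)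

/-- Morphisms of `BDM` that preserve bottom. -/
def BDM.preservesBot : MorphismProperty BDM.{u} := fun _ _ h => BDM.fn h ⊥ = ⊥

/-- Sup-homomorphisms: for every finite (possibly empty) `A` and every `b`, if each upper bound
of `A` is above `b`, then each upper bound of `h[A]` is above `h b`. -/
def BDM.isSup : MorphismProperty BDM.{u} := fun L _ h =>
  ∀ (A : Set L) (b : L), A.Finite →
    (⋂ a ∈ A, Ici a) ⊆ Ici b → (⋂ a ∈ A, Ici (BDM.fn h a)) ⊆ Ici (BDM.fn h b)

instance : BDM.preservesBot.{u}.IsMultiplicative where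
  id_mem _ := rfl
  comp_mem {L K M} h k hh hk := by
    change BDM.fn k (BDM.fn h ⊥) = ⊥
    rw [show BDM.fn h ⊥ = ⊥ from hh]
    exact hk

instance : BDM.isSup.{u}.IsMultiplicative where
  id_mem _ := fun _ _ _ hA => hA
  comp_mem {L K M} h k hh hk := by
    intro A b hA hb
    have := hk (BDM.fn h '' A) (BDM.fn h b) (hA.image _)
      (by rw [biInter_image]; exact hh A b hA hb)
    rw [biInter_image] at this
    exact this

/-- `BDM^⊥`: bounded distributive meet semi-lattices and bounded homomorphisms. -/
abbrev BDMBot : Type (u + 1) := WideSubcategory BDM.preservesBot.{u}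

/-- `BDM^S`: bounded distributive meet semi-lattices and sup-homomorphisms. -/
abbrev BDMSup : Type (u + 1) := WideSubcategory BDM.isSup.{u}

section Filters

variable (L : Type u) [SemilatticeInf L]

/-- A filter is prime (i.e. meet-prime) if it is proper and contains `F₁` or `F₂` whenever it
contains the intersection `F₁ ∩ F₂` of two filters. -/
def IsPrimeFilter {L : Type u} [SemilatticeInf L] (F : Order.PFilter L) : Prop :=
  (F : Set L) ≠ univ ∧
    ∀ F₁ F₂ : Order.PFilter L, (F₁ : Set L) ∩ F₂ ⊆ F → F₁ ≤ F ∨ F₂ ≤ F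

/-- The set `Pr(L)` of prime filters. -/
def PrimeFilters : Type u := {F : Order.PFilter L // IsPrimeFilter F}

/-- `σ(a)` is the set of prime filters that contain `a`. -/
def stoneMap (a : L) : Set (PrimeFilters L) := {x | a ∈ x.1}

/-- The distributive envelope `D(L)`: the sublattice of the power set of `Pr(L)` generated by
the sets `σ(a)`. -/
def distEnvelope : Sublattice (Set (PrimeFilters L)) where
  carrier := latticeClosure (range (stoneMap L))
  supClosed' := isSublattice_latticeClosure.supClosed
  infClosed' := isSublattice_latticeClosure.infClosed

/-- `σ` as a map from `L` to `D(L)`. -/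
def stoneEmb (a : L) : distEnvelope L := ⟨stoneMap L a, subset_latticeClosure ⟨a, rfl⟩⟩

/-- A filter of `L` is optimal if it is `σ⁻¹(P)` for some prime filter `P` of `D(L)`. -/
def IsOptimalFilter {L : Type u} [SemilatticeInf L] (F : Order.PFilter L) : Prop :=
  ∃ P : Order.PFilter (distEnvelope L), IsPrimeFilter P ∧ (F : Set L) = stoneEmb L ⁻¹' P

/-- The set `L_* = Opt(L)` of optimal filters, ordered by inclusion. -/
def Opt : Type u := {F : Order.PFilter L // IsOptimalFilter F}

instance Opt.partialOrder : PartialOrder (Opt L) where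
  le x y := (x.1 : Set L) ⊆ y.1
  le_refl _ := Subset.rfl
  le_trans _ _ _ h h' := h.trans h'
  le_antisymm _ _ h h' := Subtype.ext (SetLike.coe_injective (h.antisymm h'))

/-- `φ(a)` is the set of optimal filters that contain `a`. -/
def optMap (a : L) : Set (Opt L) := {x | a ∈ x.1}

/-- The topology on `L_*` with subbasis `{φ(a)} ∪ {φ(b)ᶜ}`. -/
instance Opt.topology : TopologicalSpace (Opt L) :=
  TopologicalSpace.generateFrom (range (optMap L) ∪ range fun b => (optMap L b)ᶜ)

/-- The subset `L_+` of `L_*`: the prime filters. -/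
def Opt.prime : Set (Opt L) := {x | IsPrimeFilter x.1}

end Filters

/-! ### Generalized Priestley spaces -/

/-- `U` is an admissible clopen upset: the maximal points of its complement lie in `X₀`. -/
def IsAdmissible {X : Type u} [TopologicalSpace X] [PartialOrder X] (X₀ U : Set X) : Prop :=
  IsClopen U ∧ IsUpperSet U ∧ {x | Maximal (· ∈ Uᶜ) x} ⊆ X₀

/-- The axioms of a generalized Priestley space `(X, τ, ≤, X₀)`. -/
structure IsGenPriestley {X : Type u} [TopologicalSpace X] [PartialOrder X] (X₀ : Set X) :
    Prop where
  compact : CompactSpace X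
  priestley : PriestleySpace X
  dense : Dense X₀
  exists_ge : ∀ x, ∃ y ∈ X₀, x ≤ y
  mem_iff : ∀ x, x ∈ X₀ ↔ DirectedOn (· ⊆ ·) {U | IsAdmissible X₀ U ∧ x ∉ U}
  le_iff : ∀ x y, x ≤ y ↔ ∀ U, IsAdmissible X₀ U → x ∈ U → y ∈ U

/-- Generalized Priestley spaces. -/
structure GPS : Type (u + 1) where
  carrier : Type u
  [top : TopologicalSpace carrier]
  [ord : PartialOrder carrier]
  core : Set carrier
  isGen : IsGenPriestley core

instance : CoeSort GPS.{u} (Type u) := ⟨GPS.carrier⟩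

attribute [instance] GPS.top GPS.ord

/-- The set `X^*` of admissible clopen upsets of `X`. -/
def GPS.Adm (X : GPS.{u}) : Type u := {U : Set X // IsAdmissible X.core U}

theorem IsAdmissible.inter {X : Type u} [TopologicalSpace X] [PartialOrder X] {X₀ U V : Set X}
    (hU : IsAdmissible X₀ U) (hV : IsAdmissible X₀ V) : IsAdmissible X₀ (U ∩ V) := by
  refine ⟨hU.1.inter hV.1, hU.2.1.inter hV.2.1, fun x hx => ?_⟩
  have hx' : Maximal (· ∈ (U ∩ V)ᶜ) x := hx
  by_cases h : x ∈ U
  · refine hV.2.2 ⟨fun h' => hx'.1 ⟨h, h'⟩, fun y hy hxy => hx'.2 (fun h' => hy h'.2) hxy⟩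
  · exact hU.2.2 ⟨h, fun y hy hxy => hx'.2 (fun h' => hy h'.1) hxy⟩

theorem GPS.isAdmissible_univ (X : GPS.{u}) : IsAdmissible X.core univ :=
  ⟨isClopen_univ, isUpperSet_univ, fun _ hx => (hx.1 trivial).elim⟩

theorem GPS.isAdmissible_empty (X : GPS.{u}) : IsAdmissible X.core ∅ := by
  refine ⟨isClopen_empty, isUpperSet_empty, fun x hx => ?_⟩
  obtain ⟨y, hy, hxy⟩ := X.isGen.exists_ge x
  have hx' : Maximal (· ∈ (∅ : Set X)ᶜ) x := hx
  have : y ≤ x := hx'.2 (fun h => h) hxy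
  rwa [le_antisymm hxy this]

/-- `X^*` is ordered by inclusion, and its meet is the intersection. -/
instance GPS.admInf (X : GPS.{u}) : SemilatticeInf X.Adm where
  le U V := U.1 ⊆ V.1
  le_refl _ := Subset.rfl
  le_trans _ _ _ h h' := h.trans h'
  le_antisymm _ _ h h' := Subtype.ext (h.antisymm h')
  inf U V := ⟨U.1 ∩ V.1, U.2.inter V.2⟩
  inf_le_left _ _ := inter_subset_left
  inf_le_right _ _ := inter_subset_right
  le_inf _ _ _ h h' := subset_inter h h'

instance GPS.admBdd (X : GPS.{u}) : BoundedOrder X.Adm where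
  top := ⟨univ, X.isAdmissible_univ⟩
  le_top U := subset_univ U.1
  bot := ⟨∅, X.isAdmissible_empty⟩
  bot_le U := empty_subset U.1

/-! ### Generalized Priestley morphisms -/

/-- `□_R A = {x | R[x] ⊆ A}`. -/
def relBox {X Y : Type u} (R : X → Y → Prop) (A : Set Y) : Set X := {x | {y | R x y} ⊆ A}

/-- A generalized Priestley morphism `R ⊆ X × Y`. -/
@[ext]
structure GPMor (X Y : GPS.{u}) : Type u where
  rel : X → Y → Prop
  sep : ∀ x y, ¬ rel x y → ∃ U, IsAdmissible Y.core U ∧ y ∉ U ∧ {z | rel x z} ⊆ U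
  box : ∀ U, IsAdmissible Y.core U → IsAdmissible X.core (relBox rel U)

theorem GPMor.rel_iff {X Y : GPS.{u}} (R : GPMor X Y) (x : X) (y : Y) :
    R.rel x y ↔ ∀ U, IsAdmissible Y.core U → x ∈ relBox R.rel U → y ∈ U := by
  refine ⟨fun h U _ hx => hx h, fun h => ?_⟩
  by_contra hxy
  obtain ⟨U, hU, hy, hx⟩ := R.sep x y hxy
  exact hy (h U hU hx)

/-- The map `h_R : Y^* → X^*`, `U ↦ □_R U`. -/
def GPMor.boxHom {X Y : GPS.{u}} (R : GPMor X Y) : InfTopHom Y.Adm X.Adm where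
  toFun U := ⟨relBox R.rel U.1, R.box U.1 U.2⟩
  map_inf' U V := Subtype.ext (by
    ext x
    exact ⟨fun h => ⟨fun _ hy => (h hy).1, fun _ hy => (h hy).2⟩, fun h _ hy => ⟨h.1 hy, h.2 hy⟩⟩)
  map_top' := Subtype.ext (by ext x; exact ⟨fun _ => trivial, fun _ _ _ => trivial⟩)

/-- The relation `S ∗ R`: `x (S ∗ R) z` iff `z` belongs to every admissible clopen upset `U` with
`x ∈ □_R □_S U`. -/
def starRel {X Y Z : GPS.{u}} (S : GPMor Y Z) (R : GPMor X Y) (x : X) (z : Z) : Prop :=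
  ∀ U, IsAdmissible Z.core U → x ∈ relBox R.rel (relBox S.rel U) → z ∈ U

theorem relBox_starRel {X Y Z : GPS.{u}} (S : GPMor Y Z) (R : GPMor X Y) {U : Set Z}
    (hU : IsAdmissible Z.core U) :
    relBox (starRel S R) U = relBox R.rel (relBox S.rel U) := by
  ext x
  refine ⟨fun h => ?_, fun h z hz => hz U hU h⟩
  by_contra hx
  have := Z.isGen.compact
  let ι := {V : Set Z // IsAdmissible Z.core V ∧ x ∈ relBox R.rel (relBox S.rel V)}
  have hne : (⋂ V : ι, V.1 ∩ Uᶜ).Nonempty := by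
    have : Nonempty ι := ⟨⟨univ, Z.isAdmissible_univ, fun _ _ _ _ => trivial⟩⟩
    refine IsCompact.nonempty_iInter_of_directed_nonempty_isCompact_isClosed _ ?_ ?_ ?_ ?_
    · intro V W
      refine ⟨⟨V.1 ∩ W.1, V.2.1.inter W.2.1,
        fun y hy z hz => ⟨V.2.2 hy hz, W.2.2 hy hz⟩⟩, ?_, ?_⟩
      · exact fun z hz => ⟨hz.1.1, hz.2⟩
      · exact fun z hz => ⟨hz.1.2, hz.2⟩
    · intro V
      by_contra hV
      rw [Set.not_nonempty_iff_eq_empty] at hV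
      refine hx fun y hy z hz => ?_
      by_contra hzU
      have : z ∈ V.1 ∩ Uᶜ := ⟨V.2.2 hy hz, hzU⟩
      rw [hV] at this
      exact this
    · exact fun V => (V.2.1.1.isClosed.inter hU.1.compl.isClosed).isCompact
    · exact fun V => V.2.1.1.isClosed.inter hU.1.compl.isClosed
  obtain ⟨z, hz⟩ := hne
  rw [mem_iInter] at hz
  exact (hz ⟨univ, Z.isAdmissible_univ, fun _ _ _ _ => trivial⟩).2
    (h fun V hV hxV => (hz ⟨V, hV, hxV⟩).1)

/-- The composition `S ∗ R` of generalized Priestley morphisms. -/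
def GPMor.star {X Y Z : GPS.{u}} (S : GPMor Y Z) (R : GPMor X Y) : GPMor X Z where
  rel := starRel S R
  sep x z h := by
    simp only [starRel, not_forall] at h
    obtain ⟨U, hU, hx, hz⟩ := h
    refine ⟨U, hU, hz, ?_⟩
    rw [← relBox_starRel S R hU] at hx
    exact hx
  box U hU := by
    rw [relBox_starRel S R hU]
    exact R.box _ (S.box U hU)

theorem GPS.relBox_le (X : GPS.{u}) {U : Set X} (hU : IsUpperSet U) :
    relBox (fun x y : X => x ≤ y) U = U := by
  ext x
  exact ⟨fun h => h (le_refl x), fun h _ hxy => hU hxy h⟩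

/-- The identity morphism of `X` is the order of `X`. -/
def GPMor.idn (X : GPS.{u}) : GPMor X X where
  rel x y := x ≤ y
  sep x y h := by
    rw [X.isGen.le_iff] at h
    simp only [not_forall] at h
    obtain ⟨U, hU, hx, hy⟩ := h
    exact ⟨U, hU, hy, fun z hz => hU.2.1 hz hx⟩
  box U hU := by rwa [X.relBox_le hU.2.1]

/-- The category `GPS` of generalized Priestley spaces and generalized Priestley morphisms, with
composition `∗` and identities `≤`. -/
instance GPS.category : Category GPS.{u} where
  Hom X Y := GPMor X Y
  id X := GPMor.idn X
  comp R S := S.star R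
  id_comp {X Y} R := by
    refine GPMor.ext (funext fun x => funext fun y => propext ?_)
    rw [R.rel_iff]
    refine forall₂_congr fun U hU => ?_
    change (x ∈ relBox (fun x y : X => x ≤ y) _ → _) ↔ _
    rw [X.relBox_le (R.box U hU).2.1]
  comp_id {X Y} R := by
    refine GPMor.ext (funext fun x => funext fun y => propext ?_)
    rw [R.rel_iff]
    refine forall₂_congr fun U hU => ?_
    change (x ∈ relBox R.rel (relBox (fun x y : Y => x ≤ y) U) → _) ↔ _
    rw [Y.relBox_le hU.2.1]
  assoc {X Y Z W} R S T := by
    refine GPMor.ext (funext fun x => funext fun y => propext ?_)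
    refine forall₂_congr fun U hU => ?_
    change (x ∈ relBox (starRel S R) _ → _) ↔ (x ∈ relBox R.rel (relBox (starRel T S) U) → _)
    rw [relBox_starRel S R (T.box U hU), relBox_starRel T S hU]

/-- The underlying relation of a morphism of `GPS`. -/
def GPS.rel {X Y : GPS.{u}} (R : X ⟶ Y) : X → Y → Prop := GPMor.rel R

/-- `R` is total if `R⁻¹[Y] = X`. -/
def GPS.isTotal : MorphismProperty GPS.{u} := fun X Y R => {x : X | ∃ y : Y, GPS.rel R x y} = univ

/-- `R` is functional if every `R[x]` is of the form `↑y`. -/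
def GPS.isFunctional : MorphismProperty GPS.{u} := fun X Y R =>
  ∀ x : X, ∃ y : Y, {z | GPS.rel R x z} = Ici y

theorem starRel_iff_of_functional {X Y Z : GPS.{u}} (S : GPMor Y Z) (R : GPMor X Y)
    {x : X} {y : Y} {z : Z} (hy : {w | R.rel x w} = Ici y) (hz : {w | S.rel y w} = Ici z) :
    {w | starRel S R x w} = Ici z := by
  have key : ∀ U, IsAdmissible Z.core U → (x ∈ relBox R.rel (relBox S.rel U) ↔ z ∈ U) := by
    intro U hU
    change {w | R.rel x w} ⊆ relBox S.rel U ↔ _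
    rw [hy]
    constructor
    · intro h
      have h1 : {w | S.rel y w} ⊆ U := h (mem_Ici.2 le_rfl)
      rw [hz] at h1
      exact h1 (mem_Ici.2 le_rfl)
    · intro h w hw
      refine (S.box U hU).2.1 hw ?_
      change {w | S.rel y w} ⊆ U
      rw [hz]
      exact fun v hv => hU.2.1 hv h
  ext w
  rw [mem_Ici, Z.isGen.le_iff]
  exact forall₂_congr fun U hU => by rw [key U hU]

instance : GPS.isTotal.{u}.IsMultiplicative where
  id_mem _ := eq_univ_of_forall fun x => ⟨x, le_refl x⟩
  comp_mem {X Y Z} R S hR hS := by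
    refine eq_univ_of_forall fun x => ?_
    obtain ⟨y, hy⟩ : ∃ y, GPS.rel R x y := eq_univ_iff_forall.1 hR x
    obtain ⟨z, hz⟩ : ∃ z, GPS.rel S y z := eq_univ_iff_forall.1 hS y
    exact ⟨z, fun U _ hx => hx hy hz⟩

instance : GPS.isFunctional.{u}.IsMultiplicative where
  id_mem _ := fun x => ⟨x, rfl⟩
  comp_mem {X Y Z} R S hR hS := by
    intro x
    obtain ⟨y, hy⟩ := hR x
    obtain ⟨z, hz⟩ := hS y
    exact ⟨z, starRel_iff_of_functional S R hy hz⟩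

/-- `GPS^T`: generalized Priestley spaces and total generalized Priestley morphisms. -/
abbrev GPST : Type (u + 1) := WideSubcategory GPS.isTotal.{u}

/-- `GPS^F`: generalized Priestley spaces and functional generalized Priestley morphisms. -/
abbrev GPSF : Type (u + 1) := WideSubcategory GPS.isFunctional.{u}

/-! ### Strong Priestley morphisms -/

/-- A strong Priestley morphism: an order-preserving map under which preimages of admissible
clopen upsets are admissible clopen upsets. -/
@[ext]
structure StrongMor (X Y : GPS.{u}) : Type u where
  toFun : X → Y
  mono : Monotone toFun
  preimage : ∀ U, IsAdmissible Y.core U → IsAdmissible X.core (toFun ⁻¹' U)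

/-- The objects of `GPS^S` are the generalized Priestley spaces. -/
structure GPSS : Type (u + 1) where
  obj : GPS.{u}

/-- `GPS^S`: generalized Priestley spaces and strong Priestley morphisms, with the composition of
functions. -/
instance GPSS.category : Category GPSS.{u} where
  Hom X Y := StrongMor X.obj Y.obj
  id X := ⟨id, monotone_id, fun _ hU => hU⟩
  comp f g := ⟨g.toFun ∘ f.toFun, g.mono.comp f.mono, fun U hU => f.preimage _ (g.preimage U hU)⟩

/-- The underlying function of a morphism of `GPS^S`. -/
def GPSS.fn {X Y : GPSS.{u}} (f : X ⟶ Y) : X.obj → Y.obj := StrongMor.toFun f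

/-- The map `f⁻¹ : Y^* → X^*`. -/
def GPSS.preimageHom {X Y : GPSS.{u}} (f : X ⟶ Y) : InfTopHom Y.obj.Adm X.obj.Adm where
  toFun U := ⟨GPSS.fn f ⁻¹' U.1, StrongMor.preimage f U.1 U.2⟩
  map_inf' _ _ := rfl
  map_top' := rfl

/-- For functional `R`, the function `f^R` that sends `x` to the least element of `R[x]`. -/
noncomputable def leastFn {X Y : GPS.{u}} (R : X ⟶ Y) (hR : GPS.isFunctional R) (x : X) : Y :=
  (hR x).choose

theorem leastFn_spec {X Y : GPS.{u}} (R : X ⟶ Y) (hR : GPS.isFunctional R) (x : X) :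
    {z | GPS.rel R x z} = Ici (leastFn R hR x) :=
  (hR x).choose_spec

theorem leastFn_preimage {X Y : GPS.{u}} (R : X ⟶ Y) (hR : GPS.isFunctional R) {U : Set Y}
    (hU : IsUpperSet U) : leastFn R hR ⁻¹' U = relBox (GPS.rel R) U := by
  ext x
  change _ ↔ {z | GPS.rel R x z} ⊆ U
  rw [leastFn_spec R hR x]
  exact ⟨fun h _ hy => hU hy h, fun h => h (mem_Ici.2 le_rfl)⟩

theorem GPS.le_of_Ici_eq {X : GPS.{u}} {x y : X} (h : Ici x = Ici y) : x = y :=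
  le_antisymm (show y ∈ Ici x by rw [h]; exact mem_Ici.2 le_rfl)
    (show x ∈ Ici y by rw [← h]; exact mem_Ici.2 le_rfl)

/-- The functor `GPS^F ⥤ GPS^S` that is the identity on spaces and sends `R` to `f^R`. -/
noncomputable def functionalToStrong : GPSF.{u} ⥤ GPSS.{u} where
  obj X := ⟨X.obj⟩
  map {X Y} R :=
    { toFun := leastFn R.hom R.property
      mono := fun x x' hxx' => by
        rw [Y.obj.isGen.le_iff]
        intro U hU hx
        have h : x ∈ relBox (GPS.rel R.hom) U := by
          rw [← leastFn_preimage R.hom R.property hU.2.1]; exact hx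
        have h' := (GPMor.box R.hom U hU).2.1 hxx' h
        change x' ∈ relBox (GPS.rel R.hom) U at h'
        rw [← leastFn_preimage R.hom R.property hU.2.1] at h'
        exact h'
      preimage := fun U hU => by
        rw [leastFn_preimage R.hom R.property hU.2.1]
        exact GPMor.box R.hom U hU }
  map_id X := StrongMor.ext (funext fun x =>
    (GPS.le_of_Ici_eq (leastFn_spec (𝟙 X : X ⟶ X).hom (𝟙 X : X ⟶ X).property x)).symm)
  map_comp {X Y Z} R S := StrongMor.ext (funext fun x => GPS.le_of_Ici_eq <|
    (leastFn_spec (R ≫ S).hom (R ≫ S).property x).symm.trans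
      (starRel_iff_of_functional S.hom R.hom (leastFn_spec R.hom R.property x)
        (leastFn_spec S.hom S.property _)))

/-- The generalized Priestley morphism `R^f` of a strong Priestley morphism `f`:
`x R^f y` iff `f(x) ≤ y`. -/
def StrongMor.toGPMor {X Y : GPS.{u}} (f : StrongMor X Y) : GPMor X Y where
  rel x y := f.toFun x ≤ y
  sep x y h := (GPMor.idn Y).sep (f.toFun x) y h
  box U hU := by
    have : relBox (fun x y => f.toFun x ≤ y) U = f.toFun ⁻¹' U := by
      ext x
      exact ⟨fun h => h (le_refl (f.toFun x)), fun h _ hy => hU.2.1 hy h⟩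
    rw [this]
    exact f.preimage U hU

/-- The functor `GPS^S ⥤ GPS^F` that is the identity on spaces and sends `f` to `R^f`. -/
def strongToFunctional : GPSS.{u} ⥤ GPSF.{u} where
  obj X := ⟨X.obj⟩
  map {X Y} f := ⟨StrongMor.toGPMor f, fun x => ⟨StrongMor.toFun f x, rfl⟩⟩
  map_id X := rfl
  map_comp {X Y Z} f g := by
    refine WideSubcategory.hom_ext _ (GPMor.ext (funext fun x => funext fun z => propext ?_))
    have h := starRel_iff_of_functional (StrongMor.toGPMor g) (StrongMor.toGPMor f)
      (x := x) (y := StrongMor.toFun f x) (z := StrongMor.toFun g (StrongMor.toFun f x)) rfl rfl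
    exact (Set.ext_iff.1 h z).symm

/-! ### The dualities -/

/-- The dual `R_h ⊆ K_* × L_*` of `h : L → K`: `x R_h y` iff `h⁻¹(x) ⊆ y`. -/
def dualRel {L K : BDM.{u}} (h : L ⟶ K) (x : Opt K) (y : Opt L) : Prop :=
  BDM.fn h ⁻¹' (x.1 : Set K) ⊆ (y.1 : Set L)

/-- The equivalence `e` is given, in one direction, by `L ↦ (L_*, τ, ⊆, L_+)` and `h ↦ R_h` and,
in the other, by `X ↦ X^*` and `R ↦ h_R`; in particular these are well defined. Here `P` and `Q`
single out the morphisms of the two categories. -/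
structure IsRelationalDuality (P : MorphismProperty BDM.{u}) [P.IsMultiplicative]
    (Q : MorphismProperty GPS.{u}) [Q.IsMultiplicative]
    (e : (WideSubcategory P)ᵒᵖ ≌ WideSubcategory Q) : Prop where
  functor_obj : ∀ L : WideSubcategory P, ∃ hL : IsGenPriestley (Opt.prime L.obj),
    e.functor.obj (op L) = ⟨⟨Opt L.obj, Opt.prime L.obj, hL⟩⟩
  functor_map : ∀ {L K : WideSubcategory P} (h : L ⟶ K),
    HEq (GPS.rel (e.functor.map h.op).hom) (dualRel h.hom)
  inverse_obj : ∀ X : WideSubcategory Q, ∃ hX : IsDistribMeet X.obj.Adm,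
    e.inverse.obj X = op ⟨⟨X.obj.Adm, hX⟩⟩
  inverse_map : ∀ {X Y : WideSubcategory Q} (R : X ⟶ Y),
    HEq (BDM.fn (e.inverse.map R).unop.hom) (⇑(GPMor.boxHom R.hom))

/-- The equivalence `e` is given, in one direction, by `L ↦ (L_*, τ, ⊆, L_+)` and `h ↦ h⁻¹` and,
in the other, by `X ↦ X^*` and `f ↦ f⁻¹`; in particular these are well defined. -/
structure IsPreimageDuality (e : BDMSup.{u}ᵒᵖ ≌ GPSS.{u}) : Prop where
  functor_obj : ∀ L : BDMSup.{u}, ∃ hL : IsGenPriestley (Opt.prime L.obj),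
    e.functor.obj (op L) = ⟨⟨Opt L.obj, Opt.prime L.obj, hL⟩⟩
  functor_map : ∀ {L K : BDMSup.{u}} (h : L ⟶ K), ∃ g : Opt K.obj → Opt L.obj,
    (∀ x, ((g x).1 : Set L.obj) = BDM.fn h.hom ⁻¹' (x.1 : Set K.obj)) ∧
      HEq (GPSS.fn (e.functor.map h.op)) g
  inverse_obj : ∀ X : GPSS.{u}, ∃ hX : IsDistribMeet X.obj.Adm,
    e.inverse.obj X = op ⟨⟨X.obj.Adm, hX⟩⟩
  inverse_map : ∀ {X Y : GPSS.{u}} (f : X ⟶ Y),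
    HEq (BDM.fn (e.inverse.map f).unop.hom) (⇑(GPSS.preimageHom f))

/-! ### Prime and optimal filters -/

/-! Everything rests on reading finite joins that need not exist. Say that a finite `A` covers `b`
if every upper bound of `A` is above `b`. By the prime filter theorem this holds iff `σ(b) ⊆ ⋃
σ(a)`, so optimal filters are exactly the filters that meet `A` whenever they contain an element
covered by `A` (`isOptimalFilter_iff`). This removes `D(L)` from the argument and makes `L_*`
compact.

Compactness then identifies the admissible sets of `L_*` with the sets `φ(a)` (`isAdmissible_iff`),
so `L ≅ (L_*)^*`. Conversely, density of `X₀` turns covering in `X^*` into inclusion in a union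
(`biInter_Ici_subset_iff`), so points of `X` evaluate to optimal filters of `X^*`; compactness makes
evaluation onto, and `X ≅ (X^*)_*`.

A generalized Priestley morphism is determined by its box operator on admissible sets, `∗` is
composition of these operators, and `□_{R_h} φ(a) = φ(h(a))`. Functoriality and naturality become
identities between boxes. Preserving `⊥` matches totality, preserving covers matches functionality,
and for functional `R` the box is the preimage under `f^R`. -/

theorem DirectedOn.exists_upper_bound_of_finite {α : Type*} [Preorder α] {s A : Set α}
    (hd : DirectedOn (· ≤ ·) s) (hne : s.Nonempty) (hA : A.Finite) (hAs : A ⊆ s) :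
    ∃ c ∈ s, ∀ a ∈ A, a ≤ c := by
  induction A, hA using Set.Finite.induction_on with
  | empty => exact hne.imp fun c hc => ⟨hc, fun a ha => ha.elim⟩
  | @insert a A _ _ ih =>
    obtain ⟨c, hc, hAc⟩ := ih ((subset_insert a A).trans hAs)
    obtain ⟨d, hd, had, hcd⟩ := hd a (hAs (mem_insert a A)) c hc
    refine ⟨d, hd, fun b hb => ?_⟩
    rcases hb with rfl | hb
    · exact had
    · exact (hAc b hb).trans hcd

section Filters

variable {L : Type u} [SemilatticeInf L]

/-- The filter on a subset that contains `⊤` and is closed under meets and upwards. -/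
def Order.PFilter.ofSet [OrderTop L] (s : Set L) (htop : ⊤ ∈ s)
    (hinf : ∀ a ∈ s, ∀ b ∈ s, a ⊓ b ∈ s) (hup : IsUpperSet s) : Order.PFilter L :=
  IsPFilter.toPFilter (F := s) <| IsPFilter.of_def ⟨⊤, htop⟩
    (fun a ha b hb => ⟨a ⊓ b, hinf a ha b hb, inf_le_left, inf_le_right⟩)
    fun hxy hx => hup hxy hx

/-- In one direction apply primeness to principal filters: an element of `↑a ∩ ↑b` outside `F` is an
upper bound of `a` and `b` in the complement. -/
theorem isPrimeFilter_iff {F : Order.PFilter L} :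
    IsPrimeFilter F ↔ (F : Set L) ≠ univ ∧ DirectedOn (· ≤ ·) (F : Set L)ᶜ := by
  refine and_congr_right fun _ => ⟨fun h a ha b hb => ?_, fun h F₁ F₂ hF => ?_⟩
  · by_contra hc
    push Not at hc
    rcases h (Order.PFilter.principal a) (Order.PFilter.principal b) (fun c hc' => by
      by_contra hcF
      exact hc c hcF hc'.1 hc'.2) with h | h
    · exact ha (Order.PFilter.principal_le_iff.1 h)
    · exact hb (Order.PFilter.principal_le_iff.1 h)
  · by_contra hc
    rw [not_or] at hc
    obtain ⟨a, ha, haF⟩ := not_subset.1 hc.1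
    obtain ⟨b, hb, hbF⟩ := not_subset.1 hc.2
    obtain ⟨c, hcF, hac, hbc⟩ := h a haF b hbF
    exact hcF (hF ⟨F₁.mem_of_le hac ha, F₂.mem_of_le hbc hb⟩)

/-- The prime filter theorem. -/
theorem IsDistribMeet.exists_isPrimeFilter [OrderTop L] (hL : IsDistribMeet L)
    {F : Order.PFilter L} {a : L} (ha : a ∉ F) :
    ∃ G : Order.PFilter L, IsPrimeFilter G ∧ F ≤ G ∧ a ∉ G := by
  obtain ⟨M, hFM, hM⟩ := zorn_le_nonempty₀ {G : Order.PFilter L | a ∉ G} (by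
    intro c hc hchain y hy
    refine ⟨Order.PFilter.ofSet (⋃ G ∈ c, (G : Set L)) ?_ ?_ ?_, ?_, ?_⟩
    · exact mem_biUnion hy Order.PFilter.top_mem
    · intro x hx z hz
      simp only [mem_iUnion₂] at hx hz ⊢
      obtain ⟨G, hG, hxG⟩ := hx
      obtain ⟨H, hH, hzH⟩ := hz
      rcases hchain.total hG hH with h | h
      · exact ⟨H, hH, Order.PFilter.inf_mem (h hxG) hzH⟩
      · exact ⟨G, hG, Order.PFilter.inf_mem hxG (h hzH)⟩
    · intro x z hxz hx
      simp only [mem_iUnion₂] at hx ⊢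
      obtain ⟨G, hG, hxG⟩ := hx
      exact ⟨G, hG, G.mem_of_le hxz hxG⟩
    · intro h
      obtain ⟨G, hG, haG⟩ := mem_iUnion₂.1 h
      exact hc hG haG
    · exact fun G hG x hx => mem_biUnion hG hx) F ha
  have haM : a ∉ M := hM.1
  -- By maximality the filter generated by `M` and `b` must contain `a`.
  have key : ∀ b ∉ M, ∃ m ∈ M, m ⊓ b ≤ a := by
    intro b hb
    by_contra h
    push Not at h
    let N : Order.PFilter L := Order.PFilter.ofSet {x | ∃ m ∈ M, m ⊓ b ≤ x}
      ⟨⊤, Order.PFilter.top_mem, le_top⟩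
      (by
        rintro x ⟨m, hm, hx⟩ y ⟨n, hn, hy⟩
        refine ⟨m ⊓ n, Order.PFilter.inf_mem hm hn, le_inf ?_ ?_⟩
        · exact (inf_le_inf_right b inf_le_left).trans hx
        · exact (inf_le_inf_right b inf_le_right).trans hy)
      (by
        rintro x y hxy ⟨m, hm, hx⟩
        exact ⟨m, hm, hx.trans hxy⟩)
    have hN : a ∉ N := fun ⟨m, hm, hma⟩ => h m hm hma
    have hMN : M ≤ N := fun x hx => ⟨x, hx, inf_le_left⟩
    exact hb (hM.2 hN hMN (show b ∈ N from ⟨⊤, Order.PFilter.top_mem, inf_le_right⟩))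
  refine ⟨M, isPrimeFilter_iff.2 ⟨fun h => haM (h ▸ mem_univ a : a ∈ (M : Set L)), ?_⟩, hFM, haM⟩
  intro b hb c hc
  obtain ⟨m, hm, hmb⟩ := key b hb
  obtain ⟨n, hn, hnc⟩ := key c hc
  -- Distributivity replaces `a` by a factor `c₂ ≥ b` still outside `M`. A second use, now below
  -- `c₂`, gives a factor `d₂ ≥ c` outside `M`, and `b ≤ c₂ ≤ d₂`.
  obtain ⟨c₁, c₂, h₁, h₂, rfl⟩ := hL _ _ _ hmb
  have hc₂ : c₂ ∉ M := fun h => haM (Order.PFilter.inf_mem (M.mem_of_le h₁ hm) h)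
  obtain ⟨d₁, d₂, h₃, h₄, rfl⟩ := hL _ _ _ (hnc.trans inf_le_right)
  have hd₂ : d₂ ∉ M := fun h => hc₂ (Order.PFilter.inf_mem (M.mem_of_le h₃ hn) h)
  exact ⟨d₂, hd₂, h₂.trans inf_le_right, h₄⟩

theorem IsDistribMeet.exists_isPrimeFilter_of_not_le [OrderTop L] (hL : IsDistribMeet L)
    {a b : L} (h : ¬ b ≤ a) : ∃ G : Order.PFilter L, IsPrimeFilter G ∧ b ∈ G ∧ a ∉ G := by
  obtain ⟨G, hG, hbG, haG⟩ := hL.exists_isPrimeFilter (F := Order.PFilter.principal b) (a := a) h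
  exact ⟨G, hG, Order.PFilter.principal_le_iff.1 hbG, haG⟩

/-- Whenever every upper bound of a finite set `A` is above an element of `F`, some element of
`A` belongs to `F`. -/
def IsJoinPrime (F : Set L) : Prop :=
  ∀ (A : Set L) (b : L), A.Finite → (⋂ a ∈ A, Ici a) ⊆ Ici b → b ∈ F → ∃ a ∈ A, a ∈ F

theorem IsJoinPrime.bot_notMem [OrderBot L] {F : Set L} (hF : IsJoinPrime F) : ⊥ ∉ F := by
  intro h
  obtain ⟨a, ha, -⟩ := hF ∅ ⊥ finite_empty (fun x _ => mem_Ici.2 bot_le) h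
  exact ha

theorem IsPrimeFilter.compl_nonempty {F : Order.PFilter L} (hF : IsPrimeFilter F) :
    (F : Set L)ᶜ.Nonempty :=
  nonempty_compl.2 hF.1

theorem IsPrimeFilter.isJoinPrime {F : Order.PFilter L} (hF : IsPrimeFilter F) :
    IsJoinPrime (F : Set L) := by
  intro A b hA hAb hb
  by_contra h
  push Not at h
  obtain ⟨c, hc, hAc⟩ := (isPrimeFilter_iff.1 hF).2.exists_upper_bound_of_finite
    hF.compl_nonempty hA h
  exact hc (F.mem_of_le (hAb (mem_iInter₂.2 hAc)) hb)

theorem stoneMap_mono {a b : L} (h : a ≤ b) : stoneMap L a ⊆ stoneMap L b :=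
  fun x hx => x.1.mem_of_le h hx

theorem stoneMap_inf (a b : L) : stoneMap L (a ⊓ b) = stoneMap L a ∩ stoneMap L b := by
  ext x
  exact ⟨fun h => ⟨x.1.mem_of_le inf_le_left h, x.1.mem_of_le inf_le_right h⟩,
    fun h => Order.PFilter.inf_mem h.1 h.2⟩

theorem IsDistribMeet.stoneMap_subset_iff [OrderTop L] (hL : IsDistribMeet L) {a b : L} :
    stoneMap L a ⊆ stoneMap L b ↔ a ≤ b := by
  refine ⟨fun h => ?_, stoneMap_mono⟩
  by_contra hab
  obtain ⟨G, hG, haG, hbG⟩ := hL.exists_isPrimeFilter_of_not_le hab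
  exact hbG (h (show (⟨G, hG⟩ : PrimeFilters L) ∈ stoneMap L a from haG))

/-- If `c` bounds `A`, then `σ(c)` contains the union, and `σ` reflects order; conversely prime
filters are join-prime. Inclusions in `D(L)` can thus be tested inside `L`. -/
theorem IsDistribMeet.stoneMap_subset_biUnion_iff [OrderTop L] (hL : IsDistribMeet L) {A : Set L}
    (hA : A.Finite) {b : L} :
    stoneMap L b ⊆ ⋃ a ∈ A, stoneMap L a ↔ (⋂ a ∈ A, Ici a) ⊆ Ici b := by
  constructor
  · intro h c hc
    refine hL.stoneMap_subset_iff.1 (h.trans (iUnion₂_subset fun a ha => stoneMap_mono ?_))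
    exact mem_iInter₂.1 hc a ha
  · intro h x hx
    obtain ⟨a, ha, hax⟩ := x.2.isJoinPrime A b hA h hx
    exact mem_biUnion ha hax

/-- Since `σ` turns meets into intersections, finite unions of sets `σ(a)` are closed under
intersection. -/
theorem exists_eq_biUnion_of_mem_distEnvelope {S : Set (PrimeFilters L)}
    (hS : S ∈ distEnvelope L) : ∃ A : Set L, A.Finite ∧ S = ⋃ a ∈ A, stoneMap L a := by
  have : latticeClosure (range (stoneMap L)) ⊆
      {S | ∃ A : Set L, A.Finite ∧ S = ⋃ a ∈ A, stoneMap L a} := by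
    refine latticeClosure_min ?_ ⟨?_, ?_⟩
    · rintro _ ⟨a, rfl⟩
      exact ⟨{a}, finite_singleton a, by simp⟩
    · rintro _ ⟨A, hA, rfl⟩ _ ⟨B, hB, rfl⟩
      exact ⟨A ∪ B, hA.union hB, by rw [biUnion_union]; rfl⟩
    · rintro _ ⟨A, hA, rfl⟩ _ ⟨B, hB, rfl⟩
      refine ⟨image2 (· ⊓ ·) A B, hA.image2 _ hB, ?_⟩
      rw [biUnion_image2]
      ext x
      simp only [inf_eq_inter, mem_inter_iff, mem_iUnion, stoneMap_inf]
      constructor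
      · rintro ⟨⟨a, ha, hxa⟩, b, hb, hxb⟩
        exact ⟨a, ha, b, hb, hxa, hxb⟩
      · rintro ⟨a, ha, b, hb, hxa, hxb⟩
        exact ⟨⟨a, ha, hxa⟩, b, hb, hxb⟩
  exact this hS

variable [BoundedOrder L]

theorem isOptimalFilter_iff (hL : IsDistribMeet L) {F : Order.PFilter L} :
    IsOptimalFilter F ↔ IsJoinPrime (F : Set L) := by
  constructor
  · rintro ⟨P, hP, hFP⟩ A b hA hAb hb
    rw [hFP] at hb ⊢
    by_contra h
    push Not at h
    obtain ⟨T, hT, hAT⟩ := (isPrimeFilter_iff.1 hP).2.exists_upper_bound_of_finite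
      hP.compl_nonempty (hA.image (stoneEmb L)) (image_subset_iff.2 h)
    refine hT (P.mem_of_le ?_ hb)
    change stoneMap L b ⊆ T.1
    exact ((hL.stoneMap_subset_biUnion_iff hA).2 hAb).trans
      (iUnion₂_subset fun a ha => hAT _ (mem_image_of_mem _ ha))
  · intro hF
    have : OrderTop (distEnvelope L) :=
      { top := stoneEmb L ⊤
        le_top := fun S x _ => Order.PFilter.top_mem }
    -- The filter of `D(L)` generated by `σ[F]`. Its complement is closed under unions because `F`
    -- is join-prime.
    let P : Order.PFilter (distEnvelope L) :=
      Order.PFilter.ofSet {S | ∃ b ∈ F, stoneMap L b ⊆ S.1}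
        ⟨⊤, Order.PFilter.top_mem, fun x _ => (le_top : stoneEmb L ⊤ ≤ ⊤) Order.PFilter.top_mem⟩
        (by
          rintro S ⟨b, hb, hbS⟩ T ⟨c, hc, hcT⟩
          exact ⟨b ⊓ c, Order.PFilter.inf_mem hb hc, by
            rw [stoneMap_inf]; exact inter_subset_inter hbS hcT⟩)
        (by
          rintro S T hST ⟨b, hb, hbS⟩
          exact ⟨b, hb, hbS.trans hST⟩)
    have hmem : ∀ S, S ∈ P ↔ ∃ b ∈ F, stoneMap L b ⊆ S.1 := fun S => Iff.rfl
    refine ⟨P, isPrimeFilter_iff.2 ⟨?_, ?_⟩, ?_⟩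
    · intro h
      obtain ⟨b, hb, hb'⟩ := (hmem (stoneEmb L ⊥)).1 (by
        rw [← SetLike.mem_coe, h]; exact mem_univ _)
      have := hL.stoneMap_subset_iff.1 hb'
      exact hF.bot_notMem (F.mem_of_le this hb)
    · intro S hS T hT
      refine ⟨S ⊔ T, ?_, le_sup_left, le_sup_right⟩
      rintro ⟨b, hb, hbST⟩
      obtain ⟨A, hA, hSA⟩ := exists_eq_biUnion_of_mem_distEnvelope S.2
      obtain ⟨B, hB, hTB⟩ := exists_eq_biUnion_of_mem_distEnvelope T.2
      have hsub : stoneMap L b ⊆ ⋃ a ∈ A ∪ B, stoneMap L a := by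
        rw [biUnion_union, ← hSA, ← hTB]
        exact hbST
      obtain ⟨a, ha, haF⟩ :=
        hF _ b (hA.union hB) ((hL.stoneMap_subset_biUnion_iff (hA.union hB)).1 hsub) hb
      rcases ha with ha | ha
      · refine hS ⟨a, haF, ?_⟩
        change _ ⊆ S.1
        rw [hSA]
        exact subset_biUnion_of_mem (u := stoneMap L) ha
      · refine hT ⟨a, haF, ?_⟩
        change _ ⊆ T.1
        rw [hTB]
        exact subset_biUnion_of_mem (u := stoneMap L) ha
    · ext a
      refine ⟨fun h => ⟨a, h, Subset.rfl⟩, ?_⟩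
      rintro ⟨b, hb, hba⟩
      exact F.mem_of_le (hL.stoneMap_subset_iff.1 hba) hb

/-- The optimal filter on a set with the characteristic properties. -/
def Opt.ofSet (hL : IsDistribMeet L) (s : Set L) (htop : ⊤ ∈ s)
    (hinf : ∀ a ∈ s, ∀ b ∈ s, a ⊓ b ∈ s) (hup : IsUpperSet s) (hs : IsJoinPrime s) : Opt L :=
  ⟨Order.PFilter.ofSet s htop hinf hup, (isOptimalFilter_iff hL).2 hs⟩

theorem Opt.isJoinPrime (hL : IsDistribMeet L) (x : Opt L) : IsJoinPrime (x.1 : Set L) :=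
  (isOptimalFilter_iff hL).1 x.2

theorem IsDistribMeet.exists_mem_prime (hL : IsDistribMeet L) {F : Order.PFilter L} {a : L}
    (ha : a ∉ F) : ∃ x ∈ Opt.prime L, (F : Set L) ⊆ x.1 ∧ a ∉ x.1 := by
  obtain ⟨G, hG, hFG, haG⟩ := hL.exists_isPrimeFilter ha
  exact ⟨⟨G, (isOptimalFilter_iff hL).2 hG.isJoinPrime⟩, hG, hFG, haG⟩

theorem IsDistribMeet.optMap_subset_iff (hL : IsDistribMeet L) {a b : L} :
    optMap L a ⊆ optMap L b ↔ a ≤ b := by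
  refine ⟨fun h => ?_, fun h x hx => x.1.mem_of_le h hx⟩
  by_contra hab
  obtain ⟨x, -, hax, hbx⟩ := hL.exists_mem_prime (F := Order.PFilter.principal a) (a := b) hab
  exact hbx (h (hax (Order.PFilter.mem_principal.2 le_rfl)))

end Filters

/-! ### The dual space of a distributive meet semi-lattice -/

section Space

variable {L : Type u} [SemilatticeInf L]

theorem isClopen_optMap (a : L) : IsClopen (optMap L a) :=
  ⟨⟨TopologicalSpace.isOpen_generateFrom_of_mem (Or.inr ⟨a, rfl⟩)⟩,
    TopologicalSpace.isOpen_generateFrom_of_mem (Or.inl ⟨a, rfl⟩)⟩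

theorem isUpperSet_optMap (a : L) : IsUpperSet (optMap L a) := fun _ _ hxy hx => hxy hx

theorem optMap_inf (a b : L) : optMap L (a ⊓ b) = optMap L a ∩ optMap L b := by
  ext x
  exact ⟨fun h => ⟨x.1.mem_of_le inf_le_left h, x.1.mem_of_le inf_le_right h⟩,
    fun h => Order.PFilter.inf_mem h.1 h.2⟩

instance Opt.priestleySpace : PriestleySpace (Opt L) where
  priestley {x y} h := by
    obtain ⟨a, hax, hay⟩ := not_subset.1 h
    exact ⟨optMap L a, isClopen_optMap a, isUpperSet_optMap a, hax, hay⟩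

variable [BoundedOrder L]

/-- An ultrafilter `f` converges to `{a | φ(a) ∈ f}`. This filter is join-prime because an
ultrafilter containing a finite union contains one of its members. -/
theorem IsDistribMeet.compactSpace_opt (hL : IsDistribMeet L) : CompactSpace (Opt L) := by
  refine ⟨isCompact_iff_ultrafilter_le_nhds.2 fun f _ => ?_⟩
  refine ⟨Opt.ofSet hL {a | optMap L a ∈ f} ?_ ?_ ?_ ?_, mem_univ _, ?_⟩
  · exact Filter.univ_mem' fun x => Order.PFilter.top_mem
  · intro a ha b hb
    rw [mem_ofPred_eq, optMap_inf]
    exact Filter.inter_mem ha hb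
  · intro a b hab ha
    exact Filter.mem_of_superset ha fun x hx => x.1.mem_of_le hab hx
  · intro A b hA hAb hb
    have : ⋃ a ∈ A, optMap L a ∈ f := Filter.mem_of_superset hb fun x hx => by
      obtain ⟨a, ha, hax⟩ := x.isJoinPrime hL A b hA hAb hx
      exact mem_biUnion ha hax
    exact (Ultrafilter.finite_biUnion_mem_iff hA).1 this
  · rw [TopologicalSpace.nhds_generateFrom]
    refine le_iInf₂ fun s hs => Filter.le_principal_iff.2 ?_
    obtain ⟨hs, ⟨a, rfl⟩ | ⟨a, rfl⟩⟩ := hs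
    · exact hs
    · exact Ultrafilter.compl_mem_iff_notMem.2 hs

end Space

/-! ### Maximal points of closed sets in compact Priestley spaces -/

theorem PriestleySpace.isClosed_Ici {X : Type*} [TopologicalSpace X] [Preorder X]
    [PriestleySpace X] (x : X) : IsClosed (Ici x) := by
  have : Ici x = ⋂ (U : Set X) (_ : IsClopen U ∧ IsUpperSet U ∧ x ∈ U), U := by
    ext y
    simp only [mem_Ici, mem_iInter]
    refine ⟨fun h U hU => hU.2.1 h hU.2.2, fun h => ?_⟩
    by_contra hxy
    obtain ⟨U, hU, hU', hx, hy⟩ := PriestleySpace.priestley hxy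
    exact hy (h U ⟨hU, hU', hx⟩)
  rw [this]
  exact isClosed_biInter fun U hU => hU.1.isClosed

/-- Zorn's lemma: a chain in `C` is bounded in `C` because the nested closed sets `C ∩ ↑z` have a
common point by compactness. -/
theorem PriestleySpace.exists_maximal_ge {X : Type*} [TopologicalSpace X] [PartialOrder X]
    [PriestleySpace X] [CompactSpace X] {C : Set X} (hC : IsClosed C) {x : X} (hx : x ∈ C) :
    ∃ y, x ≤ y ∧ Maximal (· ∈ C) y := by
  refine zorn_le_nonempty₀ C (fun c hcC hc y hy => ?_) x hx
  have : Nonempty c := ⟨⟨y, hy⟩⟩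
  have hne : (⋂ z : c, C ∩ Ici z.1).Nonempty := by
    refine IsCompact.nonempty_iInter_of_directed_nonempty_isCompact_isClosed _ ?_
      (fun z => ⟨z.1, hcC z.2, mem_Ici.2 le_rfl⟩)
      (fun z => (hC.inter (isClosed_Ici z.1)).isCompact)
      (fun z => hC.inter (isClosed_Ici z.1))
    intro z w
    rcases hc.total z.2 w.2 with h | h
    · exact ⟨w, inter_subset_inter_right C (Ici_subset_Ici.2 h), Subset.rfl⟩
    · exact ⟨z, Subset.rfl, inter_subset_inter_right C (Ici_subset_Ici.2 h)⟩
  obtain ⟨z, hz⟩ := hne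
  rw [mem_iInter] at hz
  exact ⟨z, (hz ⟨y, hy⟩).1, fun w hw => (hz ⟨w, hw⟩).2⟩

/-! ### Admissible sets and axioms of the dual space -/

section Space

variable {L : Type u} [SemilatticeInf L] [BoundedOrder L]

theorem IsDistribMeet.isAdmissible_optMap (hL : IsDistribMeet L) (a : L) :
    IsAdmissible (Opt.prime L) (optMap L a) := by
  refine ⟨isClopen_optMap a, isUpperSet_optMap a, fun x hx => ?_⟩
  have hx' : Maximal (· ∈ (optMap L a)ᶜ) x := hx
  obtain ⟨y, hy, hxy, hay⟩ := hL.exists_mem_prime hx'.1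
  rwa [le_antisymm (show x ≤ y from hxy) (hx'.2 hay hxy)]

/-- Two compactness arguments. A point outside `U` lies below a maximal one `z`, which is prime, so
the sets `φ(a)` with `a ∉ z` are directed; they cover `U`, and one of them contains it. Hence the
complements of the `φ(c) ⊇ U` cover `Uᶜ`, and meets make this cover directed. -/
theorem IsDistribMeet.isAdmissible_iff (hL : IsDistribMeet L) {U : Set (Opt L)} :
    IsAdmissible (Opt.prime L) U ↔ ∃ a, optMap L a = U := by
  refine ⟨fun hU => ?_, fun ⟨a, ha⟩ => ha ▸ hL.isAdmissible_optMap a⟩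
  have := hL.compactSpace_opt
  have key : ∀ y ∉ U, ∃ c, U ⊆ optMap L c ∧ y ∉ optMap L c := by
    intro y hy
    obtain ⟨z, hyz, hz⟩ := PriestleySpace.exists_maximal_ge hU.1.compl.isClosed hy
    have hzp : IsPrimeFilter z.1 := hU.2.2 hz
    have : Nonempty {a : L // a ∉ z.1} := hzp.compl_nonempty.to_subtype
    obtain ⟨⟨c, hc⟩, hUc⟩ := hU.1.isClosed.isCompact.elim_directed_cover
      (fun a : {a : L // a ∉ z.1} => optMap L a.1) (fun a => (isClopen_optMap a.1).isOpen)
      (fun x hx => by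
        have : ¬ x ≤ z := fun h => hz.1 (hU.2.1 h hx)
        obtain ⟨a, hax, haz⟩ := not_subset.1 this
        exact mem_iUnion.2 ⟨⟨a, haz⟩, hax⟩)
      (fun a b => by
        obtain ⟨c, hc, hac, hbc⟩ := (isPrimeFilter_iff.1 hzp).2 a.1 a.2 b.1 b.2
        exact ⟨⟨c, hc⟩, hL.optMap_subset_iff.2 hac, hL.optMap_subset_iff.2 hbc⟩)
    exact ⟨c, hUc, fun h => hc (hyz h)⟩
  have : Nonempty {a : L // U ⊆ optMap L a} := ⟨⟨⊤, fun x _ => Order.PFilter.top_mem⟩⟩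
  obtain ⟨⟨c, hc⟩, hUc⟩ := hU.1.compl.isClosed.isCompact.elim_directed_cover
    (fun a : {a : L // U ⊆ optMap L a} => (optMap L a.1)ᶜ)
    (fun a => (isClopen_optMap a.1).compl.isOpen)
    (fun y hy => by
      obtain ⟨c, hc, hyc⟩ := key y hy
      exact mem_iUnion.2 ⟨⟨c, hc⟩, hyc⟩)
    (fun a b => ⟨⟨a.1 ⊓ b.1, by rw [optMap_inf]; exact subset_inter a.2 b.2⟩,
      compl_subset_compl.2 (hL.optMap_subset_iff.2 inf_le_left),
      compl_subset_compl.2 (hL.optMap_subset_iff.2 inf_le_right)⟩)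
  exact ⟨c, (compl_subset_compl.1 hUc).antisymm hc⟩

theorem IsDistribMeet.dense_prime (hL : IsDistribMeet L) : Dense (Opt.prime L) := by
  rw [(TopologicalSpace.isTopologicalBasis_of_subbasis (α := Opt L) rfl).dense_iff]
  rintro _ ⟨f, ⟨hf, hfs⟩, rfl⟩ ⟨x, hx⟩
  have hinj : Function.Injective (optMap L) := fun a b h =>
    le_antisymm (hL.optMap_subset_iff.1 h.subset) (hL.optMap_subset_iff.1 h.superset)
  have hA : {a | (optMap L a)ᶜ ∈ f ∧ a ∉ x.1}.Finite :=
    (hf.preimage (compl_injective.comp hinj).injOn).subset fun a ha => ha.1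
  have hB : {b | optMap L b ∈ f ∧ b ∈ x.1}.Finite :=
    (hf.preimage hinj.injOn).subset fun a ha => ha.1
  obtain ⟨b, hbx, hb⟩ := DirectedOn.exists_upper_bound_of_finite (α := Lᵒᵈ)
    x.1.directed x.1.nonempty hB fun a ha => ha.2
  -- The basic open set asks to contain finitely many elements, bounded below by `b ∈ x`, and to
  -- avoid a finite set. As `x` is join-prime, that set does not cover `b`: it has an upper bound
  -- `c` with `b ≰ c`, and a prime filter containing `b` but not `c` will do.
  have hAb : ¬ (⋂ a ∈ {a | (optMap L a)ᶜ ∈ f ∧ a ∉ x.1}, Ici a) ⊆ Ici b := by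
    intro h
    obtain ⟨a, ha, hax⟩ := x.isJoinPrime hL _ b hA h hbx
    exact ha.2 hax
  obtain ⟨c, hAc, hbc⟩ := not_subset.1 hAb
  obtain ⟨y, hy, hby, hcy⟩ :=
    hL.exists_mem_prime (F := Order.PFilter.principal b) (a := c) hbc
  refine ⟨y, fun s hs => ?_, hy⟩
  rcases hfs hs with ⟨a, rfl⟩ | ⟨a, rfl⟩
  · exact hby (Order.PFilter.mem_principal.2 (hb a ⟨hs, hx _ hs⟩))
  · exact fun hay => hcy (y.1.mem_of_le (mem_iInter₂.1 hAc a ⟨hs, hx _ hs⟩) hay)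

theorem IsDistribMeet.isGenPriestley (hL : IsDistribMeet L) : IsGenPriestley (Opt.prime L) where
  compact := hL.compactSpace_opt
  priestley := inferInstance
  dense := hL.dense_prime
  exists_ge x := by
    obtain ⟨y, hy, hxy, -⟩ := hL.exists_mem_prime (x.isJoinPrime hL).bot_notMem
    exact ⟨y, hy, hxy⟩
  mem_iff x := by
    refine isPrimeFilter_iff.trans ⟨?_, ?_⟩
    · rintro ⟨-, h⟩ U ⟨hU, hxU⟩ V ⟨hV, hxV⟩
      obtain ⟨a, rfl⟩ := hL.isAdmissible_iff.1 hU
      obtain ⟨b, rfl⟩ := hL.isAdmissible_iff.1 hV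
      obtain ⟨c, hc, hac, hbc⟩ := h a hxU b hxV
      exact ⟨optMap L c, ⟨hL.isAdmissible_optMap c, hc⟩, hL.optMap_subset_iff.2 hac,
        hL.optMap_subset_iff.2 hbc⟩
    · intro h
      refine ⟨fun h' => (x.isJoinPrime hL).bot_notMem (h' ▸ mem_univ _), fun a ha b hb => ?_⟩
      obtain ⟨U, ⟨hU, hxU⟩, haU, hbU⟩ := h _ ⟨hL.isAdmissible_optMap a, ha⟩ _
        ⟨hL.isAdmissible_optMap b, hb⟩
      obtain ⟨c, rfl⟩ := hL.isAdmissible_iff.1 hU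
      exact ⟨c, hxU, hL.optMap_subset_iff.1 haU, hL.optMap_subset_iff.1 hbU⟩
  le_iff x y := by
    refine ⟨fun h U hU hx => hU.2.1 h hx, fun h a ha => h _ (hL.isAdmissible_optMap a) ha⟩

end Space

/-! ### The semi-lattice of admissible clopen upsets -/

namespace GPS

variable (X : GPS.{u})

instance : CompactSpace X := X.isGen.compact

instance : PriestleySpace X := X.isGen.priestley

variable {X}

theorem Adm.directedOn {x : X} (hx : x ∈ X.core) :
    DirectedOn (· ≤ ·) {U : X.Adm | x ∉ U.1} := by
  intro U hU V hV
  obtain ⟨W, ⟨hW, hxW⟩, hUW, hVW⟩ := (X.isGen.mem_iff x).1 hx U.1 ⟨U.2, hU⟩ V.1 ⟨V.2, hV⟩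
  exact ⟨⟨W, hW⟩, hxW, hUW, hVW⟩

/-- If `V` is not inside the union, the difference is open and nonempty, so density yields a core
point `y` in it. Directedness at `y` gives an admissible upper bound of `A` that misses `y ∈ V`. -/
theorem Adm.biInter_Ici_subset_iff {A : Set X.Adm} (hA : A.Finite) {V : X.Adm} :
    (⋂ U ∈ A, Ici U) ⊆ Ici V ↔ V.1 ⊆ ⋃ U ∈ A, U.1 := by
  constructor
  · intro h
    by_contra hV
    have hopen : IsOpen (V.1 \ ⋃ U ∈ A, U.1) :=
      V.2.1.isOpen.sdiff (hA.isClosed_biUnion fun U _ => U.2.1.isClosed)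
    obtain ⟨y, hy, hyX⟩ := X.isGen.dense.inter_open_nonempty _ hopen
      (nonempty_of_not_subset hV)
    obtain ⟨W, hyW, hW⟩ := (Adm.directedOn hyX).exists_upper_bound_of_finite
      ⟨⊥, notMem_empty y⟩ hA (fun U hU hyU => hy.2 (mem_biUnion hU hyU))
    exact hyW ((show V ≤ W from h (mem_iInter₂.2 hW)) hy.1)
  · intro h W hW
    exact h.trans (iUnion₂_subset fun U hU => mem_iInter₂.1 hW U hU)

theorem Adm.isDistribMeet : IsDistribMeet X.Adm := by
  intro V U₁ U₂ hV
  -- Candidate factors of `V`. A maximal point outside `V` is in the core and misses `U₁` or `U₂`;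
  -- directedness provides one factor missing it, and `⊤` serves as the other. Compactness selects a
  -- single pair.
  let ι := {W : X.Adm × X.Adm // (U₁ ≤ W.1 ∧ V ≤ W.1) ∧ U₂ ≤ W.2 ∧ V ≤ W.2}
  have : Nonempty ι := ⟨⟨(⊤, ⊤), ⟨le_top, le_top⟩, le_top, le_top⟩⟩
  obtain ⟨⟨⟨W₁, W₂⟩, h₁, h₂⟩, hW⟩ := V.2.1.compl.isClosed.isCompact.elim_directed_cover
    (fun W : ι => (W.1.1 ⊓ W.1.2).1ᶜ) (fun W => (W.1.1 ⊓ W.1.2).2.1.compl.isOpen)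
    (fun y hy => by
      obtain ⟨z, hyz, hz⟩ := PriestleySpace.exists_maximal_ge V.2.1.compl.isClosed hy
      have hdir := Adm.directedOn (V.2.2.2 hz)
      have hz' : z ∉ U₁.1 ∨ z ∉ U₂.1 := by
        rw [← not_and_or]
        exact fun h => hz.1 (hV h)
      rcases hz' with h | h
      · obtain ⟨W, hzW, hUW, hVW⟩ := hdir U₁ h V hz.1
        exact mem_iUnion.2 ⟨⟨(W, ⊤), ⟨hUW, hVW⟩, le_top, le_top⟩,
          fun hy => hzW (W.2.2.1 hyz hy.1)⟩
      · obtain ⟨W, hzW, hUW, hVW⟩ := hdir U₂ h V hz.1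
        exact mem_iUnion.2 ⟨⟨(⊤, W), ⟨le_top, le_top⟩, hUW, hVW⟩,
          fun hy => hzW (W.2.2.1 hyz hy.2)⟩)
    (fun A B => ⟨⟨(A.1.1 ⊓ B.1.1, A.1.2 ⊓ B.1.2),
        ⟨le_inf A.2.1.1 B.2.1.1, le_inf A.2.1.2 B.2.1.2⟩,
        ⟨le_inf A.2.2.1 B.2.2.1, le_inf A.2.2.2 B.2.2.2⟩⟩,
      compl_subset_compl.2 (inf_le_inf inf_le_left inf_le_left : _ ≤ A.1.1 ⊓ A.1.2),
      compl_subset_compl.2 (inf_le_inf inf_le_right inf_le_right : _ ≤ B.1.1 ⊓ B.1.2)⟩)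
  exact ⟨W₁, W₂, h₁.1, h₂.1, le_antisymm (le_inf h₁.2 h₂.2) (compl_subset_compl.1 hW)⟩

/-- The map `x ↦ {U ∈ X^* | x ∈ U}` from `X` to `(X^*)_*`. -/
def eval (x : X) : Opt X.Adm :=
  Opt.ofSet Adm.isDistribMeet {U | x ∈ U.1} (mem_univ x) (fun _ hU _ hV => ⟨hU, hV⟩)
    (fun _ _ hUV hU => hUV hU) (fun A V hA hAV hxV => by
      obtain ⟨U, hU, hxU⟩ := mem_iUnion₂.1 ((Adm.biInter_Ici_subset_iff hA).1 hAV hxV)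
      exact ⟨U, hU, hxU⟩)

theorem eval_le_eval {x y : X} : eval x ≤ eval y ↔ x ≤ y := by
  rw [X.isGen.le_iff]
  exact ⟨fun h U hU hx => h (a := ⟨U, hU⟩) hx, fun h U hx => h U.1 U.2 hx⟩

/-- The required point lies in an intersection of clopen sets. If a finite subfamily had no common
point, some `V ∈ F` would be covered by finitely many sets outside `F`, against join-primeness. -/
theorem eval_surjective : Function.Surjective (eval (X := X)) := by
  intro F
  have hF := F.isJoinPrime Adm.isDistribMeet
  have hne : (univ ∩ ⋂ U : X.Adm, {x | x ∈ U.1 ↔ U ∈ F.1}).Nonempty := by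
    classical
    refine isCompact_univ.inter_iInter_nonempty _ (fun U => ?_) fun u => ?_
    · by_cases h : U ∈ F.1
      · convert U.2.1.isClosed using 1
        ext x
        simp [h]
      · convert U.2.1.compl.isClosed using 1
        ext x
        simp [h]
    · obtain ⟨V, hV, hVu⟩ := DirectedOn.exists_upper_bound_of_finite (α := X.Admᵒᵈ)
        F.1.directed F.1.nonempty
        (u.finite_toSet.subset (inter_subset_left (t := (F.1 : Set X.Adm)))) inter_subset_right
      by_contra hcon
      have hA : {U : X.Adm | U ∈ u ∧ U ∉ F.1}.Finite := u.finite_toSet.subset fun U hU => hU.1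
      have hcover : V.1 ⊆ ⋃ U ∈ {U : X.Adm | U ∈ u ∧ U ∉ F.1}, U.1 := by
        intro x hx
        by_contra hxU
        simp only [mem_iUnion, not_exists] at hxU
        refine hcon ⟨x, mem_univ x, mem_iInter₂.2 fun U hU => ⟨fun hxU' => ?_, fun hUF => ?_⟩⟩
        · by_contra hUF
          exact hxU U ⟨hU, hUF⟩ hxU'
        · exact hVu U ⟨hU, hUF⟩ hx
      obtain ⟨U, hU, hUF⟩ := hF _ V hA ((Adm.biInter_Ici_subset_iff hA).2 hcover) hV
      exact hU.2 hUF
  obtain ⟨x, -, hx⟩ := hne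
  rw [mem_iInter] at hx
  refine ⟨x, le_antisymm (fun U hU => (hx U).1 hU) fun U hU => (hx U).2 hU⟩

end GPS

/-! ### The dual equivalences -/

theorem BDM.hom_ext {L K : BDM.{u}} {h k : L ⟶ K} (H : ∀ a, BDM.fn h a = BDM.fn k a) : h = k :=
  InfTopHom.ext H

/-- The separation axiom recovers a relation from its boxes. -/
theorem GPS.hom_ext {X Y : GPS.{u}} {R S : X ⟶ Y}
    (H : ∀ U, IsAdmissible Y.core U → relBox (GPS.rel R) U = relBox (GPS.rel S) U) : R = S := by
  refine GPMor.ext (funext fun x => funext fun y => propext ?_)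
  rw [GPMor.rel_iff R, GPMor.rel_iff S]
  exact forall₂_congr fun U hU => by rw [show relBox R.rel U = relBox S.rel U from H U hU]

theorem GPS.relBox_comp {X Y Z : GPS.{u}} (R : X ⟶ Y) (S : Y ⟶ Z) {U : Set Z}
    (hU : IsAdmissible Z.core U) :
    relBox (GPS.rel (R ≫ S)) U = relBox (GPS.rel R) (relBox (GPS.rel S) U) :=
  relBox_starRel S R hU

theorem StrongMor.relBox_toGPMor {X Y : GPS.{u}} (f : StrongMor X Y) {U : Set Y}
    (hU : IsUpperSet U) : relBox f.toGPMor.rel U = f.toFun ⁻¹' U := by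
  ext x
  exact ⟨fun h => h (le_refl (f.toFun x)), fun h _ hy => hU hy h⟩

/-- The empty set covers `⊥`. -/
theorem BDM.isSup_le_preservesBot : BDM.isSup.{u} ≤ BDM.preservesBot := by
  intro L K h hh
  exact le_bot_iff.1 (hh ∅ ⊥ finite_empty (fun _ _ => mem_Ici.2 bot_le)
    (show (⊥ : K) ∈ _ by simp))

theorem GPS.isFunctional_le_isTotal : GPS.isFunctional.{u} ≤ GPS.isTotal := by
  intro X Y R hR
  exact eq_univ_of_forall fun x => ⟨leastFn R hR x,
    (leastFn_spec R hR x).superset (mem_Ici.2 le_rfl)⟩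

/-- Order isomorphisms are isomorphisms of `BDM`. -/
def BDM.isoOfOrderIso {L K : BDM.{u}} (e : L ≃o K) : L ≅ K where
  hom := (⟨⟨e, e.map_inf⟩, e.map_top⟩ : InfTopHom L K)
  inv := (⟨⟨e.symm, e.symm.map_inf⟩, e.symm.map_top⟩ : InfTopHom K L)
  hom_inv_id := BDM.hom_ext e.symm_apply_apply
  inv_hom_id := BDM.hom_ext e.apply_symm_apply

theorem BDM.isSup_isoOfOrderIso_hom {L K : BDM.{u}} (e : L ≃o K) :
    BDM.isSup (BDM.isoOfOrderIso e).hom := by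
  intro A b _ hb c hc
  refine (e.le_symm_apply).1 (hb (mem_iInter₂.2 fun a ha => ?_))
  exact e.le_symm_apply.2 (mem_iInter₂.1 hc a ha)

theorem BDM.isSup_isoOfOrderIso_inv {L K : BDM.{u}} (e : L ≃o K) :
    BDM.isSup (BDM.isoOfOrderIso e).inv :=
  BDM.isSup_isoOfOrderIso_hom e.symm

/-- The dual space `(L_*, L_+)` of `L`. -/
abbrev BDM.dual (L : BDM.{u}) : GPS.{u} := ⟨Opt L, Opt.prime L, L.distrib.isGenPriestley⟩

/-- If `h(a) ∉ x`, the filter `h⁻¹(x)` extends to a prime filter avoiding `a`, which is an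
`R_h`-successor of `x`. -/
theorem relBox_dualRel {L K : BDM.{u}} (h : L ⟶ K) (a : L) :
    relBox (dualRel h) (optMap L a) = optMap K (BDM.fn h a) := by
  ext x
  refine ⟨fun hx => ?_, fun hx y hy => hy hx⟩
  let F : Order.PFilter L := Order.PFilter.ofSet (BDM.fn h ⁻¹' (x.1 : Set K))
    (by
      change BDM.fn h ⊤ ∈ x.1
      rw [show BDM.fn h ⊤ = ⊤ from InfTopHom.map_top' _]
      exact Order.PFilter.top_mem)
    (fun b hb c hc => by
      change BDM.fn h (b ⊓ c) ∈ x.1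
      rw [show BDM.fn h (b ⊓ c) = BDM.fn h b ⊓ BDM.fn h c from InfHom.map_inf' _ b c]
      exact Order.PFilter.inf_mem hb hc)
    (fun b c hbc hb => x.1.mem_of_le
      (OrderHomClass.mono (show InfTopHom L K from h) hbc) hb)
  by_contra ha
  obtain ⟨y, -, hFy, hay⟩ := L.distrib.exists_mem_prime (F := F) (a := a) ha
  exact hay (hx hFy)

/-- The dual relation `R_h` as a generalized Priestley morphism. -/
def BDM.dualMap {L K : BDM.{u}} (h : L ⟶ K) : K.dual ⟶ L.dual :=
  { rel := dualRel h
    sep := fun x y hxy => by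
      obtain ⟨a, hax, hay⟩ := not_subset.1 hxy
      exact ⟨optMap L a, L.distrib.isAdmissible_optMap a, hay, fun z hz => hz hax⟩
    box := fun U hU => by
      obtain ⟨a, rfl⟩ := L.distrib.isAdmissible_iff.1 hU
      change IsAdmissible (Opt.prime K) (relBox (dualRel h) (optMap L a))
      rw [relBox_dualRel]
      exact K.distrib.isAdmissible_optMap _ : GPMor K.dual L.dual }

theorem BDM.dual_hom_ext {X : GPS.{u}} {L : BDM.{u}} {R S : X ⟶ L.dual}
    (H : ∀ a, relBox (GPS.rel R) (optMap L a) = relBox (GPS.rel S) (optMap L a)) : R = S := by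
  refine GPS.hom_ext fun U hU => ?_
  obtain ⟨a, rfl⟩ := L.distrib.isAdmissible_iff.1 hU
  exact H a

theorem BDM.relBox_dualMap {L K : BDM.{u}} (h : L ⟶ K) (a : L) :
    relBox (GPS.rel (BDM.dualMap h)) (optMap L a) = optMap K (BDM.fn h a) :=
  relBox_dualRel h a

theorem BDM.dualMap_id (L : BDM.{u}) : BDM.dualMap (𝟙 L) = 𝟙 L.dual := rfl

theorem BDM.dualMap_comp {L K M : BDM.{u}} (h : L ⟶ K) (k : K ⟶ M) :
    BDM.dualMap (h ≫ k) = BDM.dualMap k ≫ BDM.dualMap h := by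
  refine BDM.dual_hom_ext fun a => ?_
  rw [GPS.relBox_comp _ _ (L.distrib.isAdmissible_optMap a), BDM.relBox_dualMap,
    BDM.relBox_dualMap, BDM.relBox_dualMap]
  rfl

/-- A point without successors would lie in `□ φ(⊥) = φ(h(⊥)) = φ(⊥)`, which is empty. -/
theorem BDM.isTotal_dualMap {L K : BDM.{u}} {h : L ⟶ K} (hh : BDM.preservesBot h) :
    GPS.isTotal (BDM.dualMap h) := by
  refine eq_univ_of_forall fun x : Opt K => ?_
  by_contra hx
  have : x ∈ relBox (dualRel h) (optMap L ⊥) := fun y hy => (hx ⟨y, hy⟩).elim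
  rw [relBox_dualRel, show BDM.fn h ⊥ = ⊥ from hh] at this
  exact (x.isJoinPrime K.distrib).bot_notMem this

/-- The optimal filter `h⁻¹(x)` for a sup-homomorphism `h`. -/
def BDM.preimageOpt {L K : BDM.{u}} (h : L ⟶ K) (hh : BDM.isSup h) (x : Opt K) : Opt L :=
  Opt.ofSet L.distrib (BDM.fn h ⁻¹' (x.1 : Set K))
    (by
      change BDM.fn h ⊤ ∈ x.1
      rw [show BDM.fn h ⊤ = ⊤ from InfTopHom.map_top' _]
      exact Order.PFilter.top_mem)
    (fun b hb c hc => by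
      change BDM.fn h (b ⊓ c) ∈ x.1
      rw [show BDM.fn h (b ⊓ c) = BDM.fn h b ⊓ BDM.fn h c from InfHom.map_inf' _ b c]
      exact Order.PFilter.inf_mem hb hc)
    (fun b c hbc hb => x.1.mem_of_le
      (OrderHomClass.mono (show InfTopHom L K from h) hbc) hb)
    (fun A b hA hAb hb => by
      obtain ⟨_, ⟨a, ha, rfl⟩, hax⟩ := x.isJoinPrime K.distrib (BDM.fn h '' A) (BDM.fn h b)
        (hA.image _) (by rw [biInter_image]; exact hh A b hA hAb) hb
      exact ⟨a, ha, hax⟩)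

theorem BDM.isFunctional_dualMap {L K : BDM.{u}} {h : L ⟶ K} (hh : BDM.isSup h) :
    GPS.isFunctional (BDM.dualMap h) :=
  fun x => ⟨BDM.preimageOpt h hh x, rfl⟩

/-- The semi-lattice `X^*` as an object of `BDM`. -/
abbrev GPS.dual (X : GPS.{u}) : BDM.{u} := ⟨X.Adm, GPS.Adm.isDistribMeet⟩

/-- The map `h_R` as a morphism of `BDM`. -/
def GPS.dualMap {X Y : GPS.{u}} (R : X ⟶ Y) : Y.dual ⟶ X.dual := GPMor.boxHom R

theorem GPS.dualMap_id (X : GPS.{u}) : GPS.dualMap (𝟙 X) = 𝟙 X.dual :=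
  BDM.hom_ext fun U : X.Adm => Subtype.ext (X.relBox_le U.2.2.1)

theorem GPS.dualMap_comp {X Y Z : GPS.{u}} (R : X ⟶ Y) (S : Y ⟶ Z) :
    GPS.dualMap (R ≫ S) = GPS.dualMap S ≫ GPS.dualMap R :=
  BDM.hom_ext fun U : Z.Adm => Subtype.ext (GPS.relBox_comp R S U.2)

theorem GPS.preservesBot_dualMap {X Y : GPS.{u}} {R : X ⟶ Y} (hR : GPS.isTotal R) :
    BDM.preservesBot (GPS.dualMap R) := by
  refine Subtype.ext (eq_empty_of_forall_notMem fun x hx => ?_)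
  obtain ⟨y, hy⟩ := eq_univ_iff_forall.1 hR x
  exact hx hy

/-- Covering in `X^*` and `Y^*` is inclusion in a union, and `h_R` is the preimage under the
least-element map, which preserves unions. -/
theorem GPS.isSup_dualMap {X Y : GPS.{u}} {R : X ⟶ Y} (hR : GPS.isFunctional R) :
    BDM.isSup (GPS.dualMap R) := by
  intro A V hA hAV
  have hV := (GPS.Adm.biInter_Ici_subset_iff (X := Y) hA).1 hAV
  have hfn : ∀ U : Y.Adm, (GPMor.boxHom R U).1 = leastFn R hR ⁻¹' U.1 := fun U =>
    (leastFn_preimage R hR U.2.2.1).symm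
  have himage : (⋂ W ∈ GPMor.boxHom R '' A, Ici W) =
      ⋂ U ∈ A, Ici (BDM.fn (GPS.dualMap R) U) := biInter_image
  rw [← himage]
  refine (GPS.Adm.biInter_Ici_subset_iff (hA.image _)).2 ?_
  rw [biUnion_image]
  change (GPMor.boxHom R V).1 ⊆ _
  rw [hfn]
  refine (preimage_mono hV).trans ?_
  rw [preimage_iUnion₂]
  exact iUnion₂_mono fun U _ => (hfn U).superset

/-- The isomorphism `a ↦ φ(a)` from `L` to `(L_*)^*`. -/
noncomputable def BDM.dualDualOrderIso (L : BDM.{u}) : L ≃o L.dual.dual :=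
  OrderIso.ofSurjective (OrderEmbedding.ofMapLEIff
    (fun a => (⟨optMap L a, L.distrib.isAdmissible_optMap a⟩ : L.dual.Adm))
    fun _ _ => L.distrib.optMap_subset_iff) fun U => by
      obtain ⟨a, ha⟩ := L.distrib.isAdmissible_iff.1 U.2
      exact ⟨a, Subtype.ext ha⟩

/-- The homeomorphism `X ≃ (X^*)_*` as an order isomorphism. -/
noncomputable def GPS.evalOrderIso (X : GPS.{u}) : X ≃o X.dual.dual :=
  OrderIso.ofSurjective (OrderEmbedding.ofMapLEIff GPS.eval fun _ _ => GPS.eval_le_eval)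
    GPS.eval_surjective

/-- The map `X → (X^*)_*` as a strong Priestley morphism. -/
noncomputable def GPS.evalMor (X : GPS.{u}) : StrongMor X X.dual.dual where
  toFun := X.evalOrderIso
  mono := X.evalOrderIso.monotone
  preimage U hU := by
    obtain ⟨V, rfl⟩ := X.dual.distrib.isAdmissible_iff.1 hU
    exact V.2

/-- The inverse of `X → (X^*)_*` as a strong Priestley morphism. -/
noncomputable def GPS.evalInvMor (X : GPS.{u}) : StrongMor X.dual.dual X where
  toFun := X.evalOrderIso.symm
  mono := X.evalOrderIso.symm.monotone
  preimage U hU := by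
    have : X.evalOrderIso.symm ⁻¹' U = optMap X.Adm ⟨U, hU⟩ := by
      ext F
      obtain ⟨x, rfl⟩ := X.evalOrderIso.surjective F
      rw [mem_preimage, OrderIso.symm_apply_apply]
      rfl
    rw [this]
    exact X.dual.distrib.isAdmissible_optMap _

/-- The isomorphism of `X` and `(X^*)_*` in `GPS`. -/
noncomputable def GPS.evalIso (X : GPS.{u}) : X ≅ X.dual.dual where
  hom := X.evalMor.toGPMor
  inv := X.evalInvMor.toGPMor
  hom_inv_id := GPS.hom_ext fun U hU => by
    rw [GPS.relBox_comp _ _ hU]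
    change relBox X.evalMor.toGPMor.rel (relBox X.evalInvMor.toGPMor.rel U) =
      relBox (fun x y : X => x ≤ y) U
    rw [X.relBox_le hU.2.1, X.evalInvMor.relBox_toGPMor hU.2.1,
      X.evalMor.relBox_toGPMor (X.evalInvMor.preimage U hU).2.1]
    exact preimage_preimage.trans (by simp [GPS.evalMor, GPS.evalInvMor])
  inv_hom_id := GPS.hom_ext fun U hU => by
    rw [GPS.relBox_comp _ _ hU]
    change relBox X.evalInvMor.toGPMor.rel (relBox X.evalMor.toGPMor.rel U) =
      relBox (fun x y : X.dual.dual => x ≤ y) U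
    rw [X.dual.dual.relBox_le hU.2.1, X.evalMor.relBox_toGPMor hU.2.1,
      X.evalInvMor.relBox_toGPMor (X.evalMor.preimage U hU).2.1]
    exact preimage_preimage.trans (by simp [GPS.evalMor, GPS.evalInvMor])

theorem StrongMor.isFunctional_toGPMor {X Y : GPS.{u}} (f : StrongMor X Y) :
    GPS.isFunctional (show X ⟶ Y from f.toGPMor) :=
  fun x => ⟨f.toFun x, rfl⟩

theorem GPS.relBox_evalIso_hom {X : GPS.{u}} (U : X.Adm) :
    relBox (GPS.rel X.evalIso.hom) (optMap X.Adm U) = U.1 :=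
  X.evalMor.relBox_toGPMor (isUpperSet_optMap U)

theorem GPS.evalIso_naturality {X Y : GPS.{u}} (R : X ⟶ Y) :
    R ≫ Y.evalIso.hom = X.evalIso.hom ≫ BDM.dualMap (GPS.dualMap R) := by
  refine BDM.dual_hom_ext fun U => ?_
  rw [GPS.relBox_comp _ _ (Y.dual.distrib.isAdmissible_optMap U),
    GPS.relBox_comp _ _ (Y.dual.distrib.isAdmissible_optMap U), BDM.relBox_dualMap,
    GPS.relBox_evalIso_hom, GPS.relBox_evalIso_hom]
  rfl

theorem BDM.dualDualOrderIso_naturality {L K : BDM.{u}} (h : L ⟶ K) :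
    (BDM.isoOfOrderIso L.dualDualOrderIso).hom ≫ GPS.dualMap (BDM.dualMap h) =
      h ≫ (BDM.isoOfOrderIso K.dualDualOrderIso).hom :=
  BDM.hom_ext fun a => Subtype.ext (BDM.relBox_dualMap h a)

/-! ### The duality for matching classes of morphisms -/

section Duality

variable {P : MorphismProperty BDM.{u}} [P.IsMultiplicative]
  {Q : MorphismProperty GPS.{u}} [Q.IsMultiplicative]

/-- The functor `L ↦ (L_*, L_+)`, `h ↦ R_h`. -/
def dualSpaceFunctor (hP : ∀ {L K : BDM.{u}} (h : L ⟶ K), P h → Q (BDM.dualMap h)) :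
    (WideSubcategory P)ᵒᵖ ⥤ WideSubcategory Q where
  obj L := ⟨L.unop.obj.dual⟩
  map h := ⟨BDM.dualMap h.unop.hom, hP _ h.unop.property⟩
  map_id L := WideSubcategory.hom_ext _ (BDM.dualMap_id L.unop.obj)
  map_comp h k := WideSubcategory.hom_ext _ (BDM.dualMap_comp k.unop.hom h.unop.hom)

/-- The functor `X ↦ X^*`, `R ↦ h_R`. -/
def admFunctor (hQ : ∀ {X Y : GPS.{u}} (R : X ⟶ Y), Q R → P (GPS.dualMap R)) :
    WideSubcategory Q ⥤ (WideSubcategory P)ᵒᵖ where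
  obj X := op ⟨X.obj.dual⟩
  map R := Quiver.Hom.op ⟨GPS.dualMap R.hom, hQ _ R.property⟩
  map_id X := Quiver.Hom.unop_inj (WideSubcategory.hom_ext _ (GPS.dualMap_id X.obj))
  map_comp R S := Quiver.Hom.unop_inj (WideSubcategory.hom_ext _ (GPS.dualMap_comp R.hom S.hom))

/-- The natural isomorphism between a semi-lattice and its double dual. -/
noncomputable def dualDualIso
    (hP : ∀ {L K : BDM.{u}} (h : L ⟶ K), P h → Q (BDM.dualMap h))
    (hQ : ∀ {X Y : GPS.{u}} (R : X ⟶ Y), Q R → P (GPS.dualMap R)) (hP' : BDM.isSup ≤ P) :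
    dualSpaceFunctor hP ⋙ admFunctor hQ ≅ 𝟭 (WideSubcategory P)ᵒᵖ :=
  NatIso.ofComponents
    (fun L => (show L.unop ≅ ⟨L.unop.obj.dual.dual⟩ from WideSubcategory.isoMk
      (BDM.isoOfOrderIso L.unop.obj.dualDualOrderIso)
      (hP' _ (BDM.isSup_isoOfOrderIso_hom _)) (hP' _ (BDM.isSup_isoOfOrderIso_inv _))).op)
    (fun h => Quiver.Hom.unop_inj (WideSubcategory.hom_ext _
      (BDM.dualDualOrderIso_naturality h.unop.hom)))

/-- The natural isomorphism between a generalized Priestley space and its double dual. -/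
noncomputable def evalNatIso
    (hP : ∀ {L K : BDM.{u}} (h : L ⟶ K), P h → Q (BDM.dualMap h))
    (hQ : ∀ {X Y : GPS.{u}} (R : X ⟶ Y), Q R → P (GPS.dualMap R)) (hQ' : GPS.isFunctional ≤ Q) :
    𝟭 (WideSubcategory Q) ≅ admFunctor hQ ⋙ dualSpaceFunctor hP :=
  NatIso.ofComponents
    (fun X => show X ≅ ⟨X.obj.dual.dual⟩ from WideSubcategory.isoMk X.obj.evalIso
      -- Both directions come from strong morphisms, so they are functional and lie in `Q`.
      (hQ' _ X.obj.evalMor.isFunctional_toGPMor) (hQ' _ X.obj.evalInvMor.isFunctional_toGPMor))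
    (fun R => WideSubcategory.hom_ext _ (GPS.evalIso_naturality R.hom))

/-- The dual equivalence between bounded distributive meet semi-lattices and generalized
Priestley spaces, for classes of morphisms that correspond to each other. -/
noncomputable def relationalDuality
    (hP : ∀ {L K : BDM.{u}} (h : L ⟶ K), P h → Q (BDM.dualMap h))
    (hQ : ∀ {X Y : GPS.{u}} (R : X ⟶ Y), Q R → P (GPS.dualMap R))
    (hP' : BDM.isSup ≤ P) (hQ' : GPS.isFunctional ≤ Q) :
    (WideSubcategory P)ᵒᵖ ≌ WideSubcategory Q :=
  CategoryTheory.Equivalence.mk (dualSpaceFunctor hP) (admFunctor hQ)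
    (dualDualIso hP hQ hP').symm (evalNatIso hP hQ hQ').symm

theorem isRelationalDuality_relationalDuality
    (hP : ∀ {L K : BDM.{u}} (h : L ⟶ K), P h → Q (BDM.dualMap h))
    (hQ : ∀ {X Y : GPS.{u}} (R : X ⟶ Y), Q R → P (GPS.dualMap R))
    (hP' : BDM.isSup ≤ P) (hQ' : GPS.isFunctional ≤ Q) :
    IsRelationalDuality P Q (relationalDuality hP hQ hP' hQ') where
  functor_obj L := ⟨L.obj.distrib.isGenPriestley, rfl⟩
  functor_map _ := HEq.rfl
  inverse_obj _ := ⟨GPS.Adm.isDistribMeet, rfl⟩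
  inverse_map _ := HEq.rfl

end Duality

/-! ### Functional and strong morphisms -/

theorem leastFn_eq {X Y : GPS.{u}} {R : X ⟶ Y} (hR : GPS.isFunctional R) {x : X} {y : Y}
    (h : {z | GPS.rel R x z} = Ici y) : leastFn R hR x = y :=
  GPS.le_of_Ici_eq ((leastFn_spec R hR x).symm.trans h)

theorem functionalToStrong_comp_strongToFunctional :
    functionalToStrong.{u} ⋙ strongToFunctional.{u} = 𝟭 GPSF.{u} := by
  refine Functor.hext (fun _ => rfl) fun X Y R => heq_of_eq ?_
  refine WideSubcategory.hom_ext _ (GPMor.ext (funext fun x => funext fun y => propext ?_))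
  exact (Set.ext_iff.1 (leastFn_spec R.hom R.property x) y).symm

theorem strongToFunctional_comp_functionalToStrong :
    strongToFunctional.{u} ⋙ functionalToStrong.{u} = 𝟭 GPSS.{u} :=
  Functor.hext (fun _ => rfl) fun _ _ f => heq_of_eq <|
    StrongMor.ext (funext fun _ => leastFn_eq (strongToFunctional.map f).property rfl)

/-- The isomorphism of `GPS^F` and `GPS^S` as an equivalence. -/
noncomputable def functionalEquivStrong : GPSF.{u} ≌ GPSS.{u} :=
  CategoryTheory.Equivalence.mk functionalToStrong strongToFunctional
    (eqToIso functionalToStrong_comp_strongToFunctional.symm)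
    (eqToIso strongToFunctional_comp_functionalToStrong)

/-- The dual equivalence of `BDM^S` and `GPS^F`. -/
noncomputable def functionalDuality : BDMSup.{u}ᵒᵖ ≌ GPSF.{u} :=
  relationalDuality (fun _ => BDM.isFunctional_dualMap) (fun _ => GPS.isSup_dualMap) le_rfl le_rfl

/-- The least element of `R_h[x]` is `h⁻¹(x)`, and `□_{R^f}` is `f⁻¹` on upsets, so composing the
functional duality with the isomorphism yields the preimage formulas. -/
theorem isPreimageDuality_trans :
    IsPreimageDuality (functionalDuality.{u}.trans functionalEquivStrong) where
  functor_obj L := ⟨L.obj.distrib.isGenPriestley, rfl⟩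
  functor_map h := ⟨BDM.preimageOpt h.hom h.property, fun _ => rfl, heq_of_eq <| funext fun _ =>
    leastFn_eq (BDM.isFunctional_dualMap h.property) rfl⟩
  inverse_obj _ := ⟨GPS.Adm.isDistribMeet, rfl⟩
  inverse_map {_ Y} f := heq_of_eq <| funext fun U : Y.obj.Adm =>
    Subtype.ext (StrongMor.relBox_toGPMor f U.2.2.1)

theorem mainTheorem3 :
    (∃ e : BDMBot.{u}ᵒᵖ ≌ GPST.{u}, IsRelationalDuality BDM.preservesBot GPS.isTotal e) ∧
    (∃ e : BDMSup.{u}ᵒᵖ ≌ GPSF.{u}, IsRelationalDuality BDM.isSup GPS.isFunctional e) ∧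
    (functionalToStrong.{u} ⋙ strongToFunctional.{u} = 𝟭 GPSF.{u} ∧
      strongToFunctional.{u} ⋙ functionalToStrong.{u} = 𝟭 GPSS.{u}) ∧
    (∃ e : BDMSup.{u}ᵒᵖ ≌ GPSS.{u}, IsPreimageDuality e) :=
  ⟨⟨_, isRelationalDuality_relationalDuality (fun _ => BDM.isTotal_dualMap)
      (fun _ => GPS.preservesBot_dualMap) BDM.isSup_le_preservesBot
      GPS.isFunctional_le_isTotal⟩,
    ⟨functionalDuality, isRelationalDuality_relationalDuality _ _ _ _⟩,
    ⟨functionalToStrong_comp_strongToFunctional, strongToFunctional_comp_functionalToStrong⟩,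
    ⟨_, isPreimageDuality_trans⟩⟩
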